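/- Let $d\ge 3$, let $a>1$ be a real number with $\bar a:=2a^{d-1}-a^d-1>0$, and let $0<\varepsilon<\bar a$. Put $C=2\lceil 4^{a+2}\rceil$. For an irrational number $\beta$ let $(q_n)_{n\ge 0}$ denote the sequence of denominators of the convergents of its continued fraction ($q_0=1$). Let $\alpha_1,\dots,\alpha_d$ be irrational numbers whose denominators $q^{(j)}_n$ ($1\le j\le d$) satisfy $$4\,(q^{(j)}_n)^a\le q^{(j+1)}_n\le C\,(q^{(j)}_n)^a\qquad\text{for all }1\le j\le d,\ n\ge 1,$$ where $q^{(d+1)}_n:=q^{(1)}_{n+1}$. Write $\mathbb T=\mathbb R/\mathbb Z$ and define the Cantor-type sets $$F^{(j)}=\bigcap_{n=1}^{\infty}\ \bigcup_{l=0}^{q^{(j)}_n-1}\left(\frac{l}{q^{(j)}_n}+\left[-\frac{1}{\sqrt{q^{(j)}_nq^{(j)}_{n+1}}},\frac{1}{\sqrt{q^{(j)}_nq^{(j)}_{n+1}}}\right]\right)\subset\mathbb T .$$ Let $\varphi:\mathbb T^d\to\mathbb R$, $\varphi(x_1,\dots,x_d)=\varphi_1(x_1)+\dots+\varphi_d(x_d)$,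 where $$\varphi_j(x)=\sum_{n=1}^\infty\bigl(f_{n,j}(x+\alpha_j)-f_{n,j}(x)\bigr),\qquad f_{n,j}(x)=\frac{q^{(j)}_{n+1}}{(q^{(j)}_n)^{1+\bar a-\varepsilon}}\bigl(1-\cos 2\pi q^{(j)}_nx\bigr).$$ Let $T:\mathbb T^d\to\mathbb T^d$ be the rotation by $\alpha=(\alpha_1,\dots,\alpha_d)$. For $m\in\mathbb Z$ let $\varphi^{(m)}(x)=\varphi(x)+\varphi(Tx)+\dots+\varphi(T^{m-1}x)$ if $m>0$, $\varphi^{(0)}=0$, and $\varphi^{(m)}(x)=-(\varphi(T^{-1}x)+\dots+\varphi(T^{m}x))$ if $m<0$, and let $D(\alpha,\varphi)$ be the set of all $x\in\mathbb T^d$ with $|\varphi^{(m)}(x)|\to+\infty$ as $m\to\pm\infty$. Then $\dim_H F^{(j)}\ge \frac{1}{1+a^d}$ for every $1\le j\le d$. Moreover $$F^{(1)}\times\dots\times F^{(d)}\subset D(\alpha,\varphi)\qquad\text{and}\qquad \dim_H\bigl(F^{(1)}\times\dots\times F^{(d)}\bigr)\ge\frac{d}{1+a^d}>0 .$$ -/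

import Mathlib

noncomputable section

/-- The denominator `q_n` of the `n`-th convergent of the continued fraction of `α`
(`q_0 = 1`, `q_n = a_n q_{n-1} + q_{n-2}`), as a real number. -/
def cfDen (α : ℝ) (n : ℕ) : ℝ := (GenContFract.of α).dens n

/-- The number `ā = 2 a^{d-1} - a^d - 1`. -/
def aBar (d : ℕ) (a : ℝ) : ℝ := 2 * a ^ (d - 1) - a ^ d - 1

/-- The denominator following `q_n^{(j)}` in the order
`q_n^{(1)}, …, q_n^{(d)}, q_{n+1}^{(1)}, …`; the indices `1, …, d` are `0, …, d - 1` here. -/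
def nextCfDen {d : ℕ} (α : Fin d → ℝ) (n : ℕ) (j : Fin d) : ℝ :=
  if h : (j : ℕ) + 1 < d then cfDen (α ⟨(j : ℕ) + 1, h⟩) n
  else cfDen (α ⟨0, Nat.zero_lt_of_lt j.isLt⟩) (n + 1)

/-- The denominators of the irrational numbers `α_1, …, α_d` satisfy
`4 (q_n^{(j)})^a ≤ q_n^{(j+1)} ≤ C (q_n^{(j)})^a` for `1 ≤ j ≤ d` and `n ≥ 1`, where
`q_n^{(d+1)} = q_{n+1}^{(1)}` and `C = 2 ⌈4^{a+2}⌉`. -/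
def InterlacedDenominators {d : ℕ} (a : ℝ) (α : Fin d → ℝ) : Prop :=
  (∀ j, Irrational (α j)) ∧
  ∀ n : ℕ, 1 ≤ n → ∀ j : Fin d,
    4 * cfDen (α j) n ^ a ≤ nextCfDen α n j ∧
    nextCfDen α n j ≤ (2 * ⌈(4 : ℝ) ^ (a + 2)⌉₊ : ℝ) * cfDen (α j) n ^ a

/-- The representative in `[0, 1)` of a point of the circle `ℝ / ℤ`. -/
def circleRep (x : UnitAddCircle) : ℝ := (AddCircle.equivIco 1 0 x : ℝ)

/-- `f_n(x) = q_{n+1} / q_n^{1 + ā - ε} * (1 - cos (2 π q_n x))`. -/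
def bump (abar ε α : ℝ) (n : ℕ) (x : UnitAddCircle) : ℝ :=
  cfDen α (n + 1) / cfDen α n ^ (1 + abar - ε) *
    (1 - Real.cos (2 * Real.pi * cfDen α n * circleRep x))

/-- `φ_α(x) = ∑_{n ≥ 1} (f_n(x + α) - f_n(x))`. -/
def circleCocycle (abar ε α : ℝ) (x : UnitAddCircle) : ℝ :=
  ∑' n : ℕ, (bump abar ε α (n + 1) (x + (α : UnitAddCircle)) - bump abar ε α (n + 1) x)

/-- `φ(x_1, …, x_d) = φ_1(x_1) + … + φ_d(x_d)`. -/
def torusCocycle {d : ℕ} (abar ε : ℝ) (α : Fin d → ℝ) (x : Fin d → UnitAddCircle) : ℝ :=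
  ∑ j, circleCocycle abar ε (α j) (x j)

/-- The cocycle sums `φ^{(m)}`, `m ∈ ℤ`, over the rotation `T x = x + v`:
`φ^{(m)}(x) = φ(x) + φ(T x) + … + φ(T^{m-1} x)` for `m ≥ 0` and
`φ^{(m)}(x) = -(φ(T^{-1} x) + … + φ(T^m x))` for `m < 0`. -/
def cocycleSum {G : Type*} [AddCommGroup G] (v : G) (φ : G → ℝ) : ℤ → G → ℝ
  | Int.ofNat m, x => ∑ k ∈ Finset.range m, φ (x + k • v)
  | Int.negSucc m, x => -∑ k ∈ Finset.range (m + 1), φ (x - (k + 1) • v)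

/-- `D(α, φ)`: the points `x` of the torus with `|φ^{(m)}(x)| → +∞` as `m → ±∞`. -/
def discreteOrbitSet {d : ℕ} (α : Fin d → ℝ) (φ : (Fin d → UnitAddCircle) → ℝ) :
    Set (Fin d → UnitAddCircle) :=
  {x | Filter.Tendsto (fun m : ℤ => |cocycleSum (fun j => (α j : UnitAddCircle)) φ m x|)
      Filter.atTop Filter.atTop ∧
    Filter.Tendsto (fun m : ℤ => |cocycleSum (fun j => (α j : UnitAddCircle)) φ m x|)
      Filter.atBot Filter.atTop}

/-- The Cantor-type set
`⋂_{n ≥ 1} ⋃_{0 ≤ l < q_n} (l / q_n + [-1 / √(q_n q_{n+1}), 1 / √(q_n q_{n+1})])`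
in the circle `ℝ / ℤ`. -/
def cantorTypeSet (α : ℝ) : Set UnitAddCircle :=
  ⋂ n : ℕ, ⋂ _ : 1 ≤ n, ⋃ l : ℕ, ⋃ _ : (l : ℝ) < cfDen α n,
    (fun t : ℝ => (t : UnitAddCircle)) ''
      Set.Icc ((l : ℝ) / cfDen α n - 1 / √(cfDen α n * cfDen α (n + 1)))
        ((l : ℝ) / cfDen α n + 1 / √(cfDen α n * cfDen α (n + 1)))

end

open Filter Topology

noncomputable section

/-! ### Continued fractions of irrational numbers -/

/-! Divergence. The sums telescope: on the `j`-th circle the cocycle sum is `∑ₙ (fₙ(x + mα) -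
fₙ(x))` with `fₙ ≥ 0`. On the Cantor-type set `qₙ x` is within `√(qₙ / qₙ₊₁)` of an integer, so `∑ₙ
fₙ(x)` converges. Each coordinate is therefore bounded below uniformly in `m`, and it is enough that
for every large `|m|` one single term `fₙ(xⱼ + mαⱼ)` be large. Since `qₙ α` lies at distance between
`1 / (2 qₙ₊₁)` and `1 / qₙ₊₁` from an integer, this term is at least `m² / (2 qₙ₊₁ qₙ^(1 + ā - ε))`
as long as `4 √(qₙ qₙ₊₁) ≤ |m| ≤ qₙ₊₁ / 4` (`le_bump_add_zsmul`). List all denominators as one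
sequence `Q`, so that `Q k` and `Q (k + d)` belong to the same circle, and choose `k` with `Q (k + d
- 1) < 4|m| ≤ Q (k + d)`. As `1 + ā = a^(d-1) (2 - a)`, the growth conditions give `Q k ^ (1 + ā) *
Q (k + d) ≤ C (4m)²`. This puts `m` in the window and makes the term at least a constant times `Q k
^ ε` (`exists_window_of_growth`).

Dimension. Mixed-radix digits of `t ∈ [0, 1)` select nested intervals, which gives a map into the
Cantor-type set whose inverse is `s`-Hölder for every `s < 1 / (1 + a^d)` (`exists_separation`,
`exists_holder_constant`). Hence its image has dimension at least `s`; the product of `d` such maps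
on `[0, 1)^d` gives `s d`. Finally `s` tends to `1 / (1 + a^d)`. -/

theorem Irrational.not_terminatedAt {α : ℝ} (h : Irrational α) (n : ℕ) :
    ¬(GenContFract.of α).TerminatedAt n := by
  intro ht
  obtain ⟨q, hq⟩ := (GenContFract.terminates_iff_rat α).1 ⟨n, ht⟩
  exact h ⟨q, hq.symm⟩

theorem exists_int_contsAux {α : ℝ} (h : Irrational α) (n : ℕ) :
    ∃ p q : ℤ, (GenContFract.of α).contsAux n = ⟨(p : ℝ), (q : ℝ)⟩ := by
  induction n using Nat.twoStepInduction with
  | zero => exact ⟨1, 0, by simp [GenContFract.contsAux]⟩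
  | one => exact ⟨⌊α⌋, 1, by simp [GenContFract.contsAux, GenContFract.of_h_eq_floor]⟩
  | more n h1 h2 =>
    obtain ⟨p, q, e⟩ := h1
    obtain ⟨p', q', e'⟩ := h2
    obtain ⟨gp, hgp⟩ := Option.ne_none_iff_exists'.1 (h.not_terminatedAt n)
    obtain ⟨ha, z, hb⟩ := GenContFract.of_partNum_eq_one_and_exists_int_partDen_eq hgp
    refine ⟨z * p' + p, z * q' + q, ?_⟩
    rw [GenContFract.contsAux_recurrence hgp e e', ha, hb]
    push_cast
    simp

theorem one_le_cfDen {α : ℝ} (h : Irrational α) (n : ℕ) : 1 ≤ cfDen α n := by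
  have h1 : ((Nat.fib (n + 1) : ℕ) : ℝ) ≤ (GenContFract.of α).dens n :=
    GenContFract.succ_nth_fib_le_of_nth_den (Or.inr (h.not_terminatedAt _))
  have h2 : (1 : ℝ) ≤ (Nat.fib (n + 1) : ℕ) := by
    exact_mod_cast Nat.fib_pos.2 n.succ_pos
  exact h2.trans h1

theorem exists_nat_cfDen {α : ℝ} (h : Irrational α) (n : ℕ) : ∃ q : ℕ, cfDen α n = q := by
  obtain ⟨p, q, e⟩ := exists_int_contsAux h (n + 1)
  have e1 : cfDen α n = q := by
    unfold cfDen
    rw [GenContFract.den_eq_conts_b, GenContFract.nth_cont_eq_succ_nth_contAux, e]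
  have h1 := one_le_cfDen h n
  rw [e1] at h1
  have h2 : (0 : ℤ) ≤ q := by exact_mod_cast zero_le_one.trans h1
  exact ⟨q.toNat, by rw [e1]; exact_mod_cast (Int.toNat_of_nonneg h2).symm⟩

theorem exists_int_nums {α : ℝ} (h : Irrational α) (n : ℕ) :
    ∃ p : ℤ, (GenContFract.of α).nums n = p := by
  obtain ⟨p, q, e⟩ := exists_int_contsAux h (n + 1)
  exact ⟨p, by rw [GenContFract.num_eq_conts_a, GenContFract.nth_cont_eq_succ_nth_contAux, e]⟩

theorem abs_cfDen_mul_sub_nums_le {α : ℝ} (h : Irrational α) (n : ℕ) :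
    |cfDen α n * α - (GenContFract.of α).nums n| ≤ 1 / cfDen α (n + 1) := by
  have h1 := GenContFract.abs_sub_convs_le (h.not_terminatedAt n)
  have hq : 0 < cfDen α n := zero_lt_one.trans_le (one_le_cfDen h n)
  have hq' : 0 < cfDen α (n + 1) := zero_lt_one.trans_le (one_le_cfDen h _)
  rw [GenContFract.conv_eq_num_div_den] at h1
  change |α - (GenContFract.of α).nums n / cfDen α n| ≤ 1 / (cfDen α n * cfDen α (n + 1)) at h1
  have e : cfDen α n * α - (GenContFract.of α).nums n =
      cfDen α n * (α - (GenContFract.of α).nums n / cfDen α n) := by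
    field_simp
  rw [e, abs_mul, abs_of_pos hq]
  calc _ ≤ cfDen α n * (1 / (cfDen α n * cfDen α (n + 1))) := by gcongr
    _ = _ := by field_simp

/-- Consecutive convergents have determinant `±1`, so `1 ≤ qₙ |v| + qₙ₊₁ |u|` for the errors `u`,
`v` at levels `n`, `n + 1`. Since `|v| ≤ 1 / qₙ₊₂` and `2 qₙ ≤ qₙ₊₂`, the first summand takes at
most half. -/
theorem le_abs_cfDen_mul_sub_nums {α : ℝ} (h : Irrational α) (n : ℕ)
    (hgrow : 2 * cfDen α n ≤ cfDen α (n + 2)) :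
    1 / (2 * cfDen α (n + 1)) ≤ |cfDen α n * α - (GenContFract.of α).nums n| := by
  have hdet : (GenContFract.of α).nums n * cfDen α (n + 1)
      - cfDen α n * (GenContFract.of α).nums (n + 1) = (-1) ^ (n + 1) :=
    SimpContFract.determinant (s := SimpContFract.of α) (h.not_terminatedAt n)
  have hq : 0 < cfDen α n := zero_lt_one.trans_le (one_le_cfDen h n)
  have hq' : 0 < cfDen α (n + 1) := zero_lt_one.trans_le (one_le_cfDen h _)
  have hq2 : 0 < cfDen α (n + 2) := zero_lt_one.trans_le (one_le_cfDen h _)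
  have h1 := abs_cfDen_mul_sub_nums_le h (n + 1)
  set u := cfDen α n * α - (GenContFract.of α).nums n
  set v := cfDen α (n + 1) * α - (GenContFract.of α).nums (n + 1)
  have e : cfDen α n * v - cfDen α (n + 1) * u = (-1) ^ (n + 1) := by
    rw [← hdet]; simp only [u, v]; ring
  have h2 : 1 ≤ cfDen α n * |v| + cfDen α (n + 1) * |u| := by
    calc (1 : ℝ) = |cfDen α n * v - cfDen α (n + 1) * u| := by rw [e]; simp
      _ ≤ |cfDen α n * v| + |cfDen α (n + 1) * u| := abs_sub _ _
      _ = _ := by rw [abs_mul, abs_mul, abs_of_pos hq, abs_of_pos hq']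
  have h3 : cfDen α n * |v| ≤ 1 / 2 := by
    calc cfDen α n * |v| ≤ cfDen α n * (1 / cfDen α (n + 2)) := by gcongr
      _ ≤ 1 / 2 := by
        rw [mul_one_div, div_le_div_iff₀ hq2 two_pos]; linarith
  rw [div_le_iff₀ (by positivity)]
  linarith

/-! ### Growth of the interlaced denominators -/

section Growth

variable {Q : ℕ → ℝ} {k₀ : ℕ} {a C : ℝ}

/-- The factor `4 ^ i` is kept because `i = d ≥ 3` later yields the ratio `64` between consecutive
denominators of one `α_j`. -/
theorem pow_mul_rpow_le_of_growth (ha : 1 < a) (hQ : ∀ k, 1 ≤ Q k)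
    (hlow : ∀ k, k₀ ≤ k → 4 * Q k ^ a ≤ Q (k + 1)) (i : ℕ) {k : ℕ} (hk : k₀ ≤ k) :
    4 ^ i * Q k ^ (a ^ i) ≤ Q (k + i) := by
  induction i with
  | zero => simp
  | succ i ih =>
    have h0 : 0 ≤ Q k := zero_le_one.trans (hQ k)
    calc (4 : ℝ) ^ (i + 1) * Q k ^ (a ^ (i + 1))
        = 4 * ((4 ^ i : ℝ) ^ (1 : ℝ) * (Q k ^ (a ^ i)) ^ a) := by
          rw [← Real.rpow_mul h0, pow_succ a, Real.rpow_one]; ring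
      _ ≤ 4 * ((4 ^ i : ℝ) ^ a * (Q k ^ (a ^ i)) ^ a) := by
          gcongr
          exact one_le_pow₀ (by norm_num)
      _ = 4 * (4 ^ i * Q k ^ (a ^ i)) ^ a := by
          rw [Real.mul_rpow (by positivity) (by positivity)]
      _ ≤ 4 * Q (k + i) ^ a := by gcongr
      _ ≤ Q (k + (i + 1)) := hlow (k + i) (by omega)

theorem exists_le_mul_rpow_of_growth (ha : 1 < a) (hQ : ∀ k, 1 ≤ Q k) (hC : 1 ≤ C)
    (hup : ∀ k, k₀ ≤ k → Q (k + 1) ≤ C * Q k ^ a) (i : ℕ) :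
    ∃ D : ℝ, 1 ≤ D ∧ ∀ k, k₀ ≤ k → Q (k + i) ≤ D * Q k ^ (a ^ i) := by
  induction i with
  | zero => exact ⟨1, le_rfl, by simp⟩
  | succ i ih =>
    obtain ⟨D, hD, h⟩ := ih
    refine ⟨C * D ^ a, one_le_mul_of_one_le_of_one_le hC
      (Real.one_le_rpow hD (zero_le_one.trans ha.le)), fun k hk => ?_⟩
    have h0 : 0 ≤ Q k := zero_le_one.trans (hQ k)
    have h1 : 0 ≤ Q (k + i) := zero_le_one.trans (hQ _)
    have hD0 : 0 ≤ D := zero_le_one.trans hD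
    calc Q (k + (i + 1)) ≤ C * Q (k + i) ^ a := hup (k + i) (by omega)
      _ ≤ C * (D * Q k ^ (a ^ i)) ^ a := by
          gcongr
          exact h k hk
      _ = C * D ^ a * Q k ^ (a ^ (i + 1)) := by
          rw [Real.mul_rpow hD0 (by positivity), ← Real.rpow_mul h0, pow_succ a]; ring

theorem four_mul_le_of_growth (ha : 1 < a) (hQ : ∀ k, 1 ≤ Q k)
    (hlow : ∀ k, k₀ ≤ k → 4 * Q k ^ a ≤ Q (k + 1)) {k : ℕ} (hk : k₀ ≤ k) :
    4 * Q k ≤ Q (k + 1) := by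
  have := Real.self_le_rpow_of_one_le (hQ k) ha.le
  linarith [hlow k hk]

theorem four_pow_le_of_growth (ha : 1 < a) (hQ : ∀ k, 1 ≤ Q k)
    (hlow : ∀ k, k₀ ≤ k → 4 * Q k ^ a ≤ Q (k + 1)) (i : ℕ) : 4 ^ i ≤ Q (k₀ + i) := by
  induction i with
  | zero => simpa using hQ k₀
  | succ i ih =>
    have := four_mul_le_of_growth ha hQ hlow (k := k₀ + i) (by omega)
    rw [← add_assoc, pow_succ]
    linarith

theorem tendsto_atTop_of_growth (ha : 1 < a) (hQ : ∀ k, 1 ≤ Q k)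
    (hlow : ∀ k, k₀ ≤ k → 4 * Q k ^ a ≤ Q (k + 1)) : Tendsto Q atTop atTop := by
  rw [← tendsto_add_atTop_iff_nat k₀]
  refine tendsto_atTop_mono (fun i => ?_) (tendsto_pow_atTop_atTop_of_one_lt (r := (4 : ℝ))
    (by norm_num))
  rw [add_comm]
  exact four_pow_le_of_growth ha hQ hlow i

/-- Every large `μ` falls into a window between consecutive terms, in which the two
quantitative estimates needed for the divergence of the cocycle hold. -/
theorem exists_window_of_growth {d : ℕ} (hd : 1 ≤ d) (ha : 1 < a) (ha2 : a < 2)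
    (hQ : ∀ k, 1 ≤ Q k) (hC : 1 ≤ C)
    (hlow : ∀ k, k₀ ≤ k → 4 * Q k ^ a ≤ Q (k + 1))
    (hup : ∀ k, k₀ ≤ k → Q (k + 1) ≤ C * Q k ^ a)
    (hbar : 0 < aBar d a) {ε : ℝ} (hε : 0 < ε) (B : ℝ) :
    ∃ M : ℝ, ∀ μ : ℝ, M ≤ μ → ∃ k, k₀ ≤ k ∧ 4 * μ ≤ Q (k + d) ∧
      256 * (Q k * Q (k + d)) ≤ (4 * μ) ^ 2 ∧
      B ≤ μ ^ 2 / (2 * (Q (k + d) * Q k ^ (1 + aBar d a - ε))) := by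
  have hC0 : 0 < C := zero_lt_one.trans_le hC
  have hQ0 : ∀ k, 0 < Q k := fun k => zero_lt_one.trans_le (hQ k)
  have htop := tendsto_atTop_of_growth ha hQ hlow
  have h1 := ((tendsto_rpow_atTop hbar).comp htop).eventually_ge_atTop (256 * C)
  have h2 := ((tendsto_rpow_atTop hε).comp htop).eventually_ge_atTop (32 * C * B)
  obtain ⟨k₁, hk₁⟩ := ((h1.and h2).and (eventually_ge_atTop k₀)).exists_forall_of_atTop
  refine ⟨Q (k₁ + d), fun μ hμ => ?_⟩
  have hk₁₀ : k₀ ≤ k₁ := (hk₁ k₁ le_rfl).2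
  have hex : ∃ i, 4 * μ ≤ Q (k₁ + d + i) := by
    obtain ⟨N, hN⟩ := (htop.eventually_ge_atTop (4 * μ)).exists_forall_of_atTop
    exact ⟨N, hN _ (by omega)⟩
  classical
  obtain ⟨i, hi, hmin⟩ : ∃ i, 4 * μ ≤ Q (k₁ + d + i) ∧ ∀ l < i, ¬ 4 * μ ≤ Q (k₁ + d + l) :=
    ⟨Nat.find hex, Nat.find_spec hex, fun l hl => Nat.find_min hex hl⟩
  have hμ0 : 0 < μ := (hQ0 _).trans_le hμ
  -- The threshold `Q (k₁ + d)` for `μ` rules out `i = 0`, so the first term reaching `4 * μ` has a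
  -- predecessor below `4 * μ`, and the resulting `k` still exceeds `k₁`.
  have hi0 : i ≠ 0 := by
    rintro rfl
    rw [add_zero] at hi
    linarith
  obtain ⟨i, rfl⟩ := Nat.exists_eq_succ_of_ne_zero hi0
  have hlt := not_le.1 (hmin i (Nat.lt_succ_self i))
  set k := k₁ + (i + 1) with hk
  have hkd : k₁ + d + (i + 1) = k + d := by omega
  have hkd' : k₁ + d + i = k + (d - 1) := by omega
  rw [Nat.succ_eq_add_one, hkd] at hi
  rw [hkd'] at hlt
  have hkk : k₀ ≤ k := by omega
  obtain ⟨⟨hk1, hk2⟩, -⟩ := hk₁ k (by omega)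
  simp only [Function.comp_apply] at hk1 hk2
  set R := Q (k + (d - 1)) with hR
  have hR0 : 0 < R := hQ0 _
  have hupR : Q (k + d) ≤ C * R ^ a := by
    have := hup (k + (d - 1)) (by omega)
    rwa [show k + (d - 1) + 1 = k + d by omega] at this
  have hRk : Q k ^ (a ^ (d - 1)) ≤ R := by
    refine le_trans ?_ (pow_mul_rpow_le_of_growth ha hQ hlow (d - 1) hkk)
    exact le_mul_of_one_le_left (by have := hQ0 k; positivity) (one_le_pow₀ (by norm_num))
  -- The identity behind the definition of `ā`: it lets the powers of `R` combine to exactly `R ^ 2`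
  -- in `hkey`.
  have hexp : a ^ (d - 1) * (2 - a) = 1 + aBar d a := by
    have : a ^ d = a ^ (d - 1) * a := by rw [← pow_succ, Nat.sub_add_cancel hd]
    rw [aBar, this]; ring
  have hkey : Q k ^ (1 + aBar d a) * Q (k + d) ≤ C * (4 * μ) ^ 2 := by
    calc Q k ^ (1 + aBar d a) * Q (k + d)
        = (Q k ^ (a ^ (d - 1))) ^ (2 - a) * Q (k + d) := by
          rw [← Real.rpow_mul (hQ0 k).le, hexp]
      _ ≤ R ^ (2 - a) * (C * R ^ a) := by
          have := hQ0 k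
          gcongr
          linarith
      _ = C * R ^ 2 := by
          rw [mul_left_comm, ← Real.rpow_add hR0]
          norm_num
      _ ≤ C * (4 * μ) ^ 2 := by gcongr
  refine ⟨k, hkk, hi, ?_, ?_⟩
  · have : 256 * C * (Q k * Q (k + d)) ≤ C * (4 * μ) ^ 2 := by
      refine le_trans ?_ hkey
      rw [Real.rpow_add (hQ0 k), Real.rpow_one]
      have h3 := hQ0 k
      have h4 := hQ0 (k + d)
      calc 256 * C * (Q k * Q (k + d)) ≤ Q k ^ aBar d a * (Q k * Q (k + d)) := by gcongr
        _ = _ := by ring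
    refine le_of_mul_le_mul_left ?_ hC0
    linarith
  · have h3 := hQ0 k
    have h4 := hQ0 (k + d)
    rw [le_div_iff₀ (by positivity)]
    have h5 : Q k ^ (1 + aBar d a) = Q k ^ ε * Q k ^ (1 + aBar d a - ε) := by
      rw [← Real.rpow_add h3]; ring_nf
    rw [h5] at hkey
    have h6 : 32 * C * B * (Q k ^ (1 + aBar d a - ε) * Q (k + d)) ≤ C * (4 * μ) ^ 2 := by
      refine le_trans ?_ hkey
      calc _ ≤ Q k ^ ε * (Q k ^ (1 + aBar d a - ε) * Q (k + d)) := by gcongr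
        _ = _ := by ring
    have h7 : (16 * C) * (B * (2 * (Q (k + d) * Q k ^ (1 + aBar d a - ε)))) ≤
        (16 * C) * μ ^ 2 := by linarith
    exact le_of_mul_le_mul_left h7 (by positivity)

end Growth

/-- The denominators `q_n^{(j)}` in their order of growth. -/
def orderedCfDen {d : ℕ} (hd : 0 < d) (α : Fin d → ℝ) (k : ℕ) : ℝ :=
  cfDen (α ⟨k % d, Nat.mod_lt _ hd⟩) (k / d)

theorem orderedCfDen_add {d : ℕ} (hd : 0 < d) (α : Fin d → ℝ) (k : ℕ) :
    orderedCfDen hd α (k + d) = cfDen (α ⟨k % d, Nat.mod_lt _ hd⟩) (k / d + 1) := by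
  simp only [orderedCfDen, Nat.add_mod_right, Nat.add_div_right k hd]

theorem orderedCfDen_mul_add {d : ℕ} (hd : 0 < d) (α : Fin d → ℝ) (n : ℕ) (j : Fin d) :
    orderedCfDen hd α (d * n + j) = cfDen (α j) n := by
  simp only [orderedCfDen, Nat.mul_add_mod, Nat.mod_eq_of_lt j.isLt,
    Nat.mul_add_div hd, Nat.div_eq_of_lt j.isLt, add_zero]

theorem nextCfDen_eq_orderedCfDen {d : ℕ} (hd : 0 < d) (α : Fin d → ℝ) (n : ℕ) (j : Fin d) :
    nextCfDen α n j = orderedCfDen hd α (d * n + j + 1) := by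
  unfold nextCfDen
  split_ifs with h
  · rw [← orderedCfDen_mul_add hd α n ⟨(j : ℕ) + 1, h⟩, add_assoc]
  · rw [← orderedCfDen_mul_add hd α (n + 1) ⟨0, _⟩]
    congr 1
    have := j.isLt
    simp only [mul_add]
    omega

section Interlaced

variable {d : ℕ} {a : ℝ} {α : Fin d → ℝ}

/-- The growth conditions start at level `n = 1`, which is position `d` in the merged sequence. -/
theorem InterlacedDenominators.ordered_low (hα : InterlacedDenominators a α) (hd : 0 < d)
    (k : ℕ) (hk : d ≤ k) :
    4 * orderedCfDen hd α k ^ a ≤ orderedCfDen hd α (k + 1) := by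
  have h := (hα.2 (k / d) ((Nat.one_le_div_iff hd).2 hk) ⟨k % d, Nat.mod_lt _ hd⟩).1
  rwa [nextCfDen_eq_orderedCfDen hd, Nat.div_add_mod] at h

theorem InterlacedDenominators.ordered_up (hα : InterlacedDenominators a α) (hd : 0 < d)
    (k : ℕ) (hk : d ≤ k) :
    orderedCfDen hd α (k + 1) ≤
      (2 * ⌈(4 : ℝ) ^ (a + 2)⌉₊ : ℝ) * orderedCfDen hd α k ^ a := by
  have h := (hα.2 (k / d) ((Nat.one_le_div_iff hd).2 hk) ⟨k % d, Nat.mod_lt _ hd⟩).2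
  rwa [nextCfDen_eq_orderedCfDen hd, Nat.div_add_mod] at h

theorem InterlacedDenominators.one_le_ordered (hα : InterlacedDenominators a α) (hd : 0 < d)
    (k : ℕ) : 1 ≤ orderedCfDen hd α k :=
  one_le_cfDen (hα.1 _) _

theorem one_le_two_mul_ceil (a : ℝ) : (1 : ℝ) ≤ 2 * ⌈(4 : ℝ) ^ (a + 2)⌉₊ := by
  have h : 0 < ⌈(4 : ℝ) ^ (a + 2)⌉₊ := Nat.ceil_pos.2 (by positivity)
  have h' : (1 : ℝ) ≤ ⌈(4 : ℝ) ^ (a + 2)⌉₊ := by exact_mod_cast h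
  linarith

theorem InterlacedDenominators.pow_mul_rpow_le (hα : InterlacedDenominators a α) (hd : 0 < d)
    (ha : 1 < a) (j : Fin d) {n : ℕ} (hn : 1 ≤ n) :
    4 ^ d * cfDen (α j) n ^ (a ^ d) ≤ cfDen (α j) (n + 1) := by
  have h := pow_mul_rpow_le_of_growth ha (hα.one_le_ordered hd) (hα.ordered_low hd) d
    (k := d * n + j) (by nlinarith)
  rwa [show d * n + (j : ℕ) + d = d * (n + 1) + j by ring, orderedCfDen_mul_add,
    orderedCfDen_mul_add] at h

theorem InterlacedDenominators.mul_le (hα : InterlacedDenominators a α) (hd : 3 ≤ d)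
    (ha : 1 < a) (j : Fin d) {n : ℕ} (hn : 1 ≤ n) :
    64 * cfDen (α j) n ≤ cfDen (α j) (n + 1) := by
  have h0 := one_le_cfDen (hα.1 j) n
  refine le_trans ?_ (hα.pow_mul_rpow_le (by omega) ha j hn)
  have h1 : (64 : ℝ) ≤ 4 ^ d := by
    calc (64 : ℝ) = 4 ^ 3 := by norm_num
      _ ≤ 4 ^ d := pow_le_pow_right₀ (by norm_num) hd
  have h2 : cfDen (α j) n ≤ cfDen (α j) n ^ (a ^ d) :=
    Real.self_le_rpow_of_one_le h0 (one_le_pow₀ ha.le)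
  gcongr

theorem InterlacedDenominators.exists_le_mul_rpow (hα : InterlacedDenominators a α)
    (hd : 0 < d) (ha : 1 < a) (j : Fin d) :
    ∃ D : ℝ, 1 ≤ D ∧ ∀ n, 1 ≤ n → cfDen (α j) (n + 1) ≤ D * cfDen (α j) n ^ (a ^ d) := by
  obtain ⟨D, hD, h⟩ := exists_le_mul_rpow_of_growth ha (hα.one_le_ordered hd)
    (one_le_two_mul_ceil a) (hα.ordered_up hd) d
  refine ⟨D, hD, fun n hn => ?_⟩
  have h := h (d * n + j) (by nlinarith)
  rwa [show d * n + (j : ℕ) + d = d * (n + 1) + j by ring, orderedCfDen_mul_add,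
    orderedCfDen_mul_add] at h

theorem InterlacedDenominators.exists_window (hα : InterlacedDenominators a α) (hd : 0 < d)
    (ha : 1 < a) (hbar : 0 < aBar d a) {ε : ℝ} (hε : 0 < ε) (B : ℝ) :
    ∃ M : ℝ, ∀ μ : ℝ, M ≤ μ → ∃ n, 1 ≤ n ∧ ∃ j, 4 * μ ≤ cfDen (α j) (n + 1) ∧
      256 * (cfDen (α j) n * cfDen (α j) (n + 1)) ≤ (4 * μ) ^ 2 ∧
      B ≤ μ ^ 2 / (2 * (cfDen (α j) (n + 1) * cfDen (α j) n ^ (1 + aBar d a - ε))) := by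
  -- Positivity of `ā` forces this, since `1 + ā = a^(d-1) (2 - a)`.
  have ha2 : a < 2 := by
    have h1 : a ^ d = a ^ (d - 1) * a := by rw [← pow_succ, Nat.sub_add_cancel hd]
    have h2 : 0 < a ^ (d - 1) * (2 - a) := by
      rw [aBar, h1] at hbar; linarith
    linarith [pos_of_mul_pos_right h2 (by positivity)]
  obtain ⟨M, hM⟩ := exists_window_of_growth hd ha ha2 (hα.one_le_ordered hd)
    (one_le_two_mul_ceil a) (hα.ordered_low hd) (hα.ordered_up hd) hbar hε B
  refine ⟨M, fun μ hμ => ?_⟩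
  obtain ⟨k, hk, h1, h2, h3⟩ := hM μ hμ
  rw [orderedCfDen_add] at h1 h2 h3
  exact ⟨k / d, (Nat.one_le_div_iff hd).2 hk, ⟨k % d, Nat.mod_lt _ hd⟩, h1, h2, h3⟩

end Interlaced

/-! ### Telescoping of the cocycle sums -/

theorem hasSum_cocycleSum {G : Type*} [AddCommGroup G] {v : G} {F : ℕ → G → ℝ}
    (hF : ∀ x, Summable fun n => F n (x + v) - F n x) (m : ℤ) (x : G) :
    HasSum (fun n => F n (x + m • v) - F n x)
      (cocycleSum v (fun y => ∑' n, (F n (y + v) - F n y)) m x) := by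
  match m with
  | Int.ofNat m =>
    have h := hasSum_sum (s := Finset.range m) fun k _ => (hF (x + k • v)).hasSum
    have e : ∀ n, ∑ k ∈ Finset.range m, (F n (x + k • v + v) - F n (x + k • v)) =
        F n (x + (Int.ofNat m) • v) - F n x := fun n => by
      have := Finset.sum_range_sub (fun k : ℕ => F n (x + k • v)) m
      simpa [succ_nsmul, add_assoc] using this
    simp only [e] at h
    exact h
  | Int.negSucc m =>
    have h := (hasSum_sum (s := Finset.range (m + 1)) fun k _ =>
      (hF (x - (k + 1) • v)).hasSum).neg
    have e : ∀ n, -∑ k ∈ Finset.range (m + 1),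
        (F n (x - (k + 1) • v + v) - F n (x - (k + 1) • v)) =
        F n (x + (Int.negSucc m) • v) - F n x := fun n => by
      have := Finset.sum_range_sub (fun k : ℕ => F n (x - k • v)) (m + 1)
      rw [← Finset.sum_neg_distrib]
      simpa [succ_nsmul, ← sub_sub, sub_eq_add_neg, add_assoc] using this
    simp only [e] at h
    exact h

theorem cocycleSum_sum {d : ℕ} {G : Type*} [AddCommGroup G] (v : Fin d → G)
    (φ : Fin d → G → ℝ) (m : ℤ) (x : Fin d → G) :
    cocycleSum v (fun y => ∑ j, φ j (y j)) m x = ∑ j, cocycleSum (v j) (φ j) m (x j) := by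
  match m with
  | Int.ofNat m => simp only [cocycleSum]; exact Finset.sum_comm
  | Int.negSucc m =>
    simp only [cocycleSum, Finset.sum_neg_distrib]
    rw [Finset.sum_comm]
    rfl

/-! ### Estimates for the bumps -/

/-- As `qₙ` is an integer, any real lift of the point may replace its representative in `[0, 1)`. -/
theorem bump_coe {α : ℝ} (h : Irrational α) (b ε : ℝ) (n : ℕ) (t : ℝ) :
    bump b ε α n (t : UnitAddCircle) =
      cfDen α (n + 1) / cfDen α n ^ (1 + b - ε) *
        (1 - Real.cos (2 * Real.pi * (cfDen α n * t))) := by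
  obtain ⟨q, hq⟩ := exists_nat_cfDen h n
  have e : circleRep (t : UnitAddCircle) = t - ⌊t⌋ := by
    rw [circleRep, AddCircle.coe_equivIco_mk_apply]
    rw [div_one, mul_one, ← Int.self_sub_floor]
  rw [bump, e, hq]
  congr 2
  rw [← Real.cos_sub_int_mul_two_pi (2 * Real.pi * (q * t)) (q * ⌊t⌋)]
  congr 1
  push_cast
  ring

theorem bump_nonneg {α : ℝ} (h : Irrational α) (b ε : ℝ) (n : ℕ) (x : UnitAddCircle) :
    0 ≤ bump b ε α n x := by
  have h1 := zero_le_one.trans (one_le_cfDen h n)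
  have h2 := zero_le_one.trans (one_le_cfDen h (n + 1))
  have h3 := Real.cos_le_one (2 * Real.pi * cfDen α n * circleRep x)
  unfold bump
  have : 0 ≤ 1 - Real.cos (2 * Real.pi * cfDen α n * circleRep x) := by linarith
  positivity

theorem cos_add_cfDen_mul {α : ℝ} (h : Irrational α) (n : ℕ) (t : ℝ) (m : ℤ) :
    Real.cos (2 * Real.pi * (cfDen α n * (t + m * α))) =
      Real.cos (2 * Real.pi *
        (cfDen α n * t + m * (cfDen α n * α - (GenContFract.of α).nums n))) := by
  obtain ⟨p, hp⟩ := exists_int_nums h n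
  rw [hp, ← Real.cos_sub_int_mul_two_pi _ (m * p)]
  congr 1
  push_cast
  ring

/-- The cosine is Lipschitz and `qₙ α` is within `1 / qₙ₊₁` of an integer, which cancels the factor
`qₙ₊₁` of the bump. The bound is uniform in `x`, so the series defining the cocycle converges
everywhere. -/
theorem abs_bump_add_sub_bump_le {α : ℝ} (h : Irrational α) (b ε : ℝ) (n : ℕ)
    (x : UnitAddCircle) :
    |bump b ε α n (x + (α : UnitAddCircle)) - bump b ε α n x| ≤
      2 * Real.pi / cfDen α n ^ (1 + b - ε) := by
  obtain ⟨t, rfl⟩ := QuotientAddGroup.mk_surjective x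
  change |bump b ε α n (((t + α : ℝ) : UnitAddCircle)) - bump b ε α n (t : UnitAddCircle)| ≤ _
  have h1 : 0 < cfDen α n := zero_lt_one.trans_le (one_le_cfDen h n)
  have h2 : 0 < cfDen α (n + 1) := zero_lt_one.trans_le (one_le_cfDen h (n + 1))
  have h3 := cos_add_cfDen_mul h n t 1
  rw [Int.cast_one, one_mul, one_mul] at h3
  rw [bump_coe h, bump_coe h, h3, ← mul_sub, sub_sub_sub_cancel_left, abs_mul,
    abs_of_pos (by positivity)]
  have h4 := Real.abs_cos_sub_cos_le (2 * Real.pi * (cfDen α n * t)) (2 * Real.pi *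
        (cfDen α n * t + (cfDen α n * α - (GenContFract.of α).nums n)))
  rw [← mul_sub, sub_add_cancel_left, mul_neg, abs_neg, abs_mul,
    abs_of_pos Real.two_pi_pos] at h4
  have h5 := abs_cfDen_mul_sub_nums_le h n
  calc _ ≤ cfDen α (n + 1) / cfDen α n ^ (1 + b - ε) * (2 * Real.pi * (1 / cfDen α (n + 1))) := by
        gcongr
        exact h4.trans (by gcongr)
    _ = _ := by field_simp

/-- Points of the Cantor-type set are close to fractions with denominator `q_n`. -/
theorem exists_of_mem_cantorTypeSet {α : ℝ} (h : Irrational α) {x : UnitAddCircle}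
    (hx : x ∈ cantorTypeSet α) {n : ℕ} (hn : 1 ≤ n) :
    ∃ t : ℝ, x = t ∧ ∃ (l : ℕ) (η : ℝ), cfDen α n * t = l + η ∧
      η ^ 2 ≤ cfDen α n / cfDen α (n + 1) := by
  simp only [cantorTypeSet, Set.mem_iInter, Set.mem_iUnion] at hx
  obtain ⟨l, -, t, ⟨ht1, ht2⟩, rfl⟩ := hx n hn
  have h1 : 0 < cfDen α n := zero_lt_one.trans_le (one_le_cfDen h n)
  have h2 : 0 < cfDen α (n + 1) := zero_lt_one.trans_le (one_le_cfDen h (n + 1))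
  refine ⟨t, rfl, l, cfDen α n * (t - l / cfDen α n), by field_simp; ring, ?_⟩
  have h3 : |t - l / cfDen α n| ≤ 1 / √(cfDen α n * cfDen α (n + 1)) := by
    rw [abs_le]; constructor <;> linarith
  rw [mul_pow, ← sq_abs (t - _)]
  calc _ ≤ cfDen α n ^ 2 * (1 / √(cfDen α n * cfDen α (n + 1))) ^ 2 := by gcongr
    _ = _ := by
      rw [div_pow, Real.sq_sqrt (by positivity)]
      field_simp

theorem bump_le_of_mem_cantorTypeSet {α : ℝ} (h : Irrational α) (b ε : ℝ) {x : UnitAddCircle}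
    (hx : x ∈ cantorTypeSet α) {n : ℕ} (hn : 1 ≤ n) :
    bump b ε α n x ≤ 2 * Real.pi ^ 2 / cfDen α n ^ (b - ε) := by
  obtain ⟨t, rfl, l, η, hl, hη⟩ := exists_of_mem_cantorTypeSet h hx hn
  have h1 : 0 < cfDen α n := zero_lt_one.trans_le (one_le_cfDen h n)
  have h2 : 0 < cfDen α (n + 1) := zero_lt_one.trans_le (one_le_cfDen h (n + 1))
  have e : Real.cos (2 * Real.pi * (l + η)) = Real.cos (2 * Real.pi * η) := by
    rw [← Real.cos_sub_nat_mul_two_pi _ l]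
    congr 1
    ring
  rw [bump_coe h, hl, e]
  have h3 := Real.one_sub_sq_div_two_le_cos (x := 2 * Real.pi * η)
  have h4 : 1 - Real.cos (2 * Real.pi * η) ≤
      2 * Real.pi ^ 2 * (cfDen α n / cfDen α (n + 1)) := by
    calc _ ≤ 2 * Real.pi ^ 2 * η ^ 2 := by linarith
      _ ≤ _ := by gcongr
  calc _ ≤ cfDen α (n + 1) / cfDen α n ^ (1 + b - ε) *
        (2 * Real.pi ^ 2 * (cfDen α n / cfDen α (n + 1))) := by gcongr
    _ = _ := by
      rw [add_sub_assoc, Real.rpow_add h1, Real.rpow_one]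
      field_simp

theorem mul_sq_le_one_sub_cos {u : ℝ} (hu : |u| ≤ 1 / 2) :
    8 * u ^ 2 ≤ 1 - Real.cos (2 * Real.pi * u) := by
  have hpi := Real.pi_pos
  have h := Real.cos_le_one_sub_mul_cos_sq (x := 2 * Real.pi * u) (by
    rw [abs_mul, abs_of_pos Real.two_pi_pos]
    nlinarith)
  have e : 2 / Real.pi ^ 2 * (2 * Real.pi * u) ^ 2 = 8 * u ^ 2 := by field_simp; ring
  linarith

/-- Modulo integers, `qₙ (x + mα)` equals `η + mδ`, where `hm'` gives `|η| ≤ |m| / (4 qₙ₊₁)` while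
`|mδ| ≥ |m| / (2 qₙ₊₁)`. The rotation thus dominates the initial offset; `hm` keeps the sum within
`1 / 2`, where `1 - cos 2πu ≥ 8u²`. -/
theorem le_bump_add_zsmul {α : ℝ} (h : Irrational α) (b ε : ℝ) {x : UnitAddCircle}
    (hx : x ∈ cantorTypeSet α) {n : ℕ} (hn : 1 ≤ n)
    (hgrow : ∀ n, 1 ≤ n → 64 * cfDen α n ≤ cfDen α (n + 1)) {m : ℤ}
    (hm : 4 * |(m : ℝ)| ≤ cfDen α (n + 1))
    (hm' : 256 * (cfDen α n * cfDen α (n + 1)) ≤ (4 * |(m : ℝ)|) ^ 2) :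
    |(m : ℝ)| ^ 2 / (2 * (cfDen α (n + 1) * cfDen α n ^ (1 + b - ε))) ≤
      bump b ε α n (x + m • (α : UnitAddCircle)) := by
  obtain ⟨t, rfl, l, η, hl, hη⟩ := exists_of_mem_cantorTypeSet h hx hn
  have h1 : 0 < cfDen α n := zero_lt_one.trans_le (one_le_cfDen h n)
  have h2 : 0 < cfDen α (n + 1) := zero_lt_one.trans_le (one_le_cfDen h (n + 1))
  have g1 := hgrow n hn
  have g2 := hgrow (n + 1) (by omega)
  have d1 := abs_cfDen_mul_sub_nums_le h n
  have d2 := le_abs_cfDen_mul_sub_nums h n (by linarith)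
  have ex : (t : UnitAddCircle) + m • (α : UnitAddCircle) = ((t + m * α : ℝ) : UnitAddCircle) := by
    rw [← zsmul_eq_mul]; rfl
  rw [ex, bump_coe h, cos_add_cfDen_mul h, hl]
  set δ := cfDen α n * α - (GenContFract.of α).nums n
  have e : Real.cos (2 * Real.pi * (l + η + m * δ)) = Real.cos (2 * Real.pi * (η + m * δ)) := by
    rw [← Real.cos_sub_nat_mul_two_pi _ l]
    congr 1
    ring
  rw [e]
  set q := cfDen α n
  set q' := cfDen α (n + 1)
  set μ := |(m : ℝ)|
  have hμ : 0 ≤ μ := abs_nonneg _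
  have hη8 : |η| ≤ 1 / 8 := by
    refine abs_le_of_sq_le_sq (hη.trans ?_) (by norm_num)
    rw [div_le_iff₀ h2]; linarith
  have hηm : |η| ≤ μ / (4 * q') := by
    refine abs_le_of_sq_le_sq (hη.trans ?_) (by positivity)
    rw [div_pow, div_le_div_iff₀ h2 (by positivity)]
    nlinarith
  have hδ1 : |m * δ| ≤ 1 / 4 := by
    rw [abs_mul]
    calc μ * |δ| ≤ μ * (1 / q') := by gcongr
      _ ≤ 1 / 4 := by rw [mul_one_div, div_le_div_iff₀ h2 (by norm_num)]; linarith
  have hδ2 : μ / (2 * q') ≤ |m * δ| := by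
    rw [abs_mul]
    calc μ / (2 * q') = μ * (1 / (2 * q')) := by ring
      _ ≤ μ * |δ| := by gcongr
  have hu1 : |η + m * δ| ≤ 1 / 2 := (abs_add_le _ _).trans (by linarith)
  have hu2 : μ / (4 * q') ≤ |η + m * δ| := by
    have := abs_sub_abs_le_abs_add (m * δ) η
    have e2 : μ / (2 * q') = μ / (4 * q') + μ / (4 * q') := by field_simp; ring
    rw [add_comm η]
    linarith
  have h5 := mul_sq_le_one_sub_cos hu1
  rw [← sq_abs] at h5
  calc μ ^ 2 / (2 * (q' * q ^ (1 + b - ε)))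
      = q' / q ^ (1 + b - ε) * (8 * (μ / (4 * q')) ^ 2) := by field_simp; ring
    _ ≤ q' / q ^ (1 + b - ε) * (8 * |η + m * δ| ^ 2) := by gcongr
    _ ≤ _ := by gcongr

/-! ### Divergence of the cocycle over the Cantor-type sets -/

theorem summable_inv_cfDen_rpow {α : ℝ} (h : Irrational α)
    (hgrow : ∀ n, 1 ≤ n → 64 * cfDen α n ≤ cfDen α (n + 1)) {s : ℝ} (hs : 0 < s) (c : ℝ) :
    Summable fun n : ℕ => c / cfDen α (n + 1) ^ s := by
  have hq : ∀ n, (64 : ℝ) ^ n ≤ cfDen α (n + 1) := fun n => by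
    induction n with
    | zero => simpa using one_le_cfDen h 1
    | succ n ih =>
      have := hgrow (n + 1) (by omega)
      rw [pow_succ]
      linarith
  have hr : ((64 : ℝ) ^ s)⁻¹ < 1 := inv_lt_one_of_one_lt₀ (Real.one_lt_rpow (by norm_num) hs)
  refine Summable.congr (f := fun n => c * (1 / cfDen α (n + 1) ^ s)) (Summable.mul_left c ?_)
    (fun n => by rw [mul_one_div])
  refine Summable.of_nonneg_of_le (fun n => ?_) (fun n => ?_)
    (summable_geometric_of_lt_one (by positivity) hr)
  · have := one_le_cfDen h (n + 1)
    positivity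
  · rw [inv_pow, ← one_div, ← Real.rpow_natCast, ← Real.rpow_mul (by norm_num), mul_comm s,
      Real.rpow_mul (by norm_num), Real.rpow_natCast]
    gcongr
    exact hq n

theorem le_cocycleSum_circleCocycle {α : ℝ} (h : Irrational α)
    (hgrow : ∀ n, 1 ≤ n → 64 * cfDen α n ≤ cfDen α (n + 1)) {b ε : ℝ} (hε : ε < b)
    {x : UnitAddCircle} (hx : x ∈ cantorTypeSet α) (m : ℤ) :
    -∑' n, bump b ε α (n + 1) x ≤
        cocycleSum (α : UnitAddCircle) (circleCocycle b ε α) m x ∧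
      ∀ n, bump b ε α (n + 1) (x + m • (α : UnitAddCircle)) - ∑' n, bump b ε α (n + 1) x ≤
        cocycleSum (α : UnitAddCircle) (circleCocycle b ε α) m x := by
  -- Summability is needed on the whole orbit of `x`, where membership in the Cantor-type set is not
  -- available.
  have hF : ∀ y : UnitAddCircle, Summable fun n =>
      bump b ε α (n + 1) (y + (α : UnitAddCircle)) - bump b ε α (n + 1) y := fun y =>
    Summable.of_norm_bounded (summable_inv_cfDen_rpow h hgrow (s := 1 + b - ε) (by linarith) _)
      fun n => abs_bump_add_sub_bump_le h b ε (n + 1) y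
  have hS : Summable fun n => bump b ε α (n + 1) x :=
    Summable.of_nonneg_of_le (fun n => bump_nonneg h b ε _ x)
      (fun n => bump_le_of_mem_cantorTypeSet h b ε hx (by omega))
      (summable_inv_cfDen_rpow h hgrow (s := b - ε) (by linarith) _)
  have hsum := hasSum_cocycleSum (F := fun n => bump b ε α (n + 1)) hF m x
  have hT := hsum.add hS.hasSum
  simp only [sub_add_cancel] at hT
  change HasSum _ (cocycleSum (α : UnitAddCircle) (circleCocycle b ε α) m x +
    ∑' n, bump b ε α (n + 1) x) at hT
  have hnn := fun n => bump_nonneg h b ε (n + 1) (x + m • (α : UnitAddCircle))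
  constructor
  · linarith [hT.nonneg hnn]
  · intro n
    linarith [le_hasSum hT n fun k _ => hnn k]

theorem pi_cantorTypeSet_subset_discreteOrbitSet {d : ℕ} (hd : 3 ≤ d) {a : ℝ} (ha : 1 < a)
    (hbar : 0 < aBar d a) {ε : ℝ} (hε : 0 < ε) (hεa : ε < aBar d a) {α : Fin d → ℝ}
    (hα : InterlacedDenominators a α) :
    Set.univ.pi (fun j : Fin d => cantorTypeSet (α j)) ⊆
      discreteOrbitSet α (torusCocycle (aBar d a) ε α) := by
  intro x hx
  rw [Set.mem_univ_pi] at hx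
  have hlow := fun j => le_cocycleSum_circleCocycle (hα.1 j)
    (fun n hn => hα.mul_le hd ha j hn) hεa (hx j)
  set S : Fin d → ℝ := fun j => ∑' n, bump (aBar d a) ε (α j) (n + 1) (x j) with hS
  have key : ∀ B : ℝ, ∃ M : ℝ, ∀ m : ℤ, M ≤ |(m : ℝ)| →
      B ≤ |cocycleSum (fun j => (α j : UnitAddCircle)) (torusCocycle (aBar d a) ε α) m x| := by
    intro B
    obtain ⟨M, hM⟩ := hα.exists_window (by omega) ha hbar hε (B + ∑ j, S j)
    refine ⟨M, fun m hm => le_trans ?_ (le_abs_self _)⟩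
    obtain ⟨n, hn, j, h1, h2, h3⟩ := hM _ hm
    have h4 := h3.trans (le_bump_add_zsmul (hα.1 j) (aBar d a) ε (hx j) hn
      (fun n hn => hα.mul_le hd ha j hn) h1 h2)
    have h5 := (hlow j m).2 (n - 1)
    rw [Nat.sub_add_cancel hn] at h5
    have e := cocycleSum_sum (fun j => (α j : UnitAddCircle))
      (fun j => circleCocycle (aBar d a) ε (α j)) m x
    change cocycleSum (fun j => (α j : UnitAddCircle)) (torusCocycle (aBar d a) ε α) m x = _ at e
    rw [e]
    have h6 : bump (aBar d a) ε (α j) n (x j + m • (α j : UnitAddCircle)) ≤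
        ∑ i, (cocycleSum (α i : UnitAddCircle) (circleCocycle (aBar d a) ε (α i)) m (x i)
          + S i) := by
      -- After adding `S i` every coordinate is nonnegative, so no other coordinate can cancel the
      -- large one.
      refine le_trans ?_ (Finset.single_le_sum (fun i _ => ?_) (Finset.mem_univ j))
      · simp only [hS]; linarith
      · have := (hlow i m).1
        simp only [hS]; linarith
    rw [Finset.sum_add_distrib] at h6
    linarith
  have habs : ∀ l : Filter ℤ, Tendsto (fun m : ℤ => |(m : ℝ)|) l atTop →
      Tendsto (fun m : ℤ => |cocycleSum (fun j => (α j : UnitAddCircle))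
        (torusCocycle (aBar d a) ε α) m x|) l atTop := by
    intro l hl
    refine tendsto_atTop.2 fun B => ?_
    obtain ⟨M, hM⟩ := key B
    filter_upwards [hl.eventually_ge_atTop M] with m hm using hM m hm
  exact ⟨habs _ (tendsto_abs_atTop_atTop.comp tendsto_intCast_atTop_atTop),
    habs _ (tendsto_abs_atBot_atTop.comp (tendsto_intCast_atBot_iff.2 tendsto_id))⟩

/-! ### An expanding parametrisation of the Cantor-type sets -/

/-- The number of subintervals of level `n + 1` used inside an interval of level `n`. -/
def childCount (w : ℕ → ℝ) (n : ℕ) : ℕ := ⌊√(w (n + 1) / w n)⌋₊ - 1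

/-- The number of intervals of level `n` used. -/
def levelCount (w : ℕ → ℝ) (n : ℕ) : ℕ := ∏ i ∈ Finset.range n, childCount w i

/-- The numerator of the midpoint of the interval of level `n` with address `t ∈ [0, 1)`. -/
def cantorIndex (w : ℕ → ℝ) (t : ℝ) : ℕ → ℕ
  | 0 => 0
  | n + 1 => ⌈w (n + 1) * (cantorIndex w t n / w n)⌉₊ +
      ⌊t * levelCount w (n + 1)⌋₊ % childCount w n

/-- The point with address `t ∈ [0, 1)`. -/
def cantorPoint (w : ℕ → ℝ) (t : ℝ) : ℝ := ⨆ n, (cantorIndex w t n : ℝ) / w n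

/-- The radius of the intervals of level `n`. -/
def cantorRadius (w : ℕ → ℝ) (n : ℕ) : ℝ := 1 / √(w n * w (n + 1))

section Cantor

variable {w : ℕ → ℝ}

theorem childCount_bounds (hw : ∀ n, 1 ≤ w n) (hg : ∀ n, 64 * w n ≤ w (n + 1)) (n : ℕ) :
    √(w (n + 1) / w n) / 2 ≤ childCount w n ∧ (childCount w n : ℝ) + 1 ≤ √(w (n + 1) / w n) ∧
      2 ≤ childCount w n := by
  have h0 : 0 < w n := zero_lt_one.trans_le (hw n)
  have h8 : 8 ≤ √(w (n + 1) / w n) := by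
    apply Real.le_sqrt_of_sq_le
    rw [le_div_iff₀ h0]
    linarith [hg n]
  have hf : 8 ≤ ⌊√(w (n + 1) / w n)⌋₊ := Nat.le_floor (by exact_mod_cast h8)
  have h1 := Nat.floor_le (Real.sqrt_nonneg (w (n + 1) / w n))
  have h2 := Nat.lt_floor_add_one (√(w (n + 1) / w n))
  have e : (childCount w n : ℝ) = ⌊√(w (n + 1) / w n)⌋₊ - 1 := by
    rw [childCount, Nat.cast_sub (by omega), Nat.cast_one]
  refine ⟨?_, ?_, by unfold childCount; omega⟩
  · rw [e]; linarith
  · rw [e]; linarith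

theorem childCount_pos (hw : ∀ n, 1 ≤ w n) (hg : ∀ n, 64 * w n ≤ w (n + 1)) (n : ℕ) :
    0 < childCount w n :=
  two_pos.trans_le (childCount_bounds hw hg n).2.2

theorem cantorRadius_le (hw : ∀ n, 1 ≤ w n) (hg : ∀ n, 64 * w n ≤ w (n + 1)) (n : ℕ) :
    cantorRadius w n ≤ 1 / (8 * w n) := by
  have h0 : 0 < w n := zero_lt_one.trans_le (hw n)
  unfold cantorRadius
  gcongr
  apply Real.le_sqrt_of_sq_le
  nlinarith [hg n]

theorem cantorIndex_div_le_succ (hw : ∀ n, 1 ≤ w n) (t : ℝ) (n : ℕ) :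
    (cantorIndex w t n : ℝ) / w n ≤ cantorIndex w t (n + 1) / w (n + 1) := by
  have h1 : 0 < w (n + 1) := zero_lt_one.trans_le (hw _)
  rw [le_div_iff₀ h1, mul_comm, cantorIndex, Nat.cast_add]
  have := Nat.le_ceil (w (n + 1) * ((cantorIndex w t n : ℝ) / w n))
  have h2 := Nat.cast_nonneg (α := ℝ) (⌊t * levelCount w (n + 1)⌋₊ % childCount w n)
  linarith

/-- In units of `1 / w (n + 1)`, rounding up costs less than `1`, the digit is at most `childCount w
n - 1`, and the child radius is at most `1`. The total stays below `childCount w n + 1`, hence below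
the parent radius; this is why `childCount` subtracts `1`. -/
theorem cantorIndex_succ_div_add_le (hw : ∀ n, 1 ≤ w n) (hg : ∀ n, 64 * w n ≤ w (n + 1))
    (t : ℝ) (n : ℕ) :
    (cantorIndex w t (n + 1) : ℝ) / w (n + 1) + cantorRadius w (n + 1) ≤
      cantorIndex w t n / w n + cantorRadius w n := by
  have h0 : 0 < w n := zero_lt_one.trans_le (hw _)
  have h1 : 0 < w (n + 1) := zero_lt_one.trans_le (hw _)
  obtain ⟨-, hN, -⟩ := childCount_bounds hw hg n
  have hpos := childCount_pos hw hg n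
  have hc := Nat.ceil_lt_add_one
    (a := w (n + 1) * ((cantorIndex w t n : ℝ) / w n)) (by positivity)
  have hu : ((⌊t * levelCount w (n + 1)⌋₊ % childCount w n : ℕ) : ℝ) + 1 ≤ childCount w n := by
    exact_mod_cast Nat.mod_lt _ hpos
  have hr1 : w (n + 1) * cantorRadius w (n + 1) ≤ 1 := by
    calc _ ≤ w (n + 1) * (1 / (8 * w (n + 1))) := by
          gcongr; exact cantorRadius_le hw hg _
      _ ≤ 1 := by field_simp; norm_num
  have hr0 : w (n + 1) * cantorRadius w n = √(w (n + 1) / w n) := by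
    rw [cantorRadius, Real.sqrt_div h1.le, Real.sqrt_mul h0.le]
    have := Real.mul_self_sqrt h1.le
    field_simp
    nlinarith
  refine le_of_mul_le_mul_left ?_ h1
  rw [mul_add, mul_add, mul_div_cancel₀ _ h1.ne', hr0, cantorIndex, Nat.cast_add]
  linarith

theorem cantorIndex_div_mono (hw : ∀ n, 1 ≤ w n) (t : ℝ) :
    Monotone fun n => (cantorIndex w t n : ℝ) / w n :=
  monotone_nat_of_le_succ (cantorIndex_div_le_succ hw t)

theorem cantorRadius_nonneg (n : ℕ) : 0 ≤ cantorRadius w n := by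
  unfold cantorRadius; positivity

theorem cantorIndex_div_le (hw : ∀ n, 1 ≤ w n) (hg : ∀ n, 64 * w n ≤ w (n + 1))
    (t : ℝ) (m n : ℕ) :
    (cantorIndex w t m : ℝ) / w m ≤ cantorIndex w t n / w n + cantorRadius w n := by
  have hanti : Antitone fun n => (cantorIndex w t n : ℝ) / w n + cantorRadius w n :=
    antitone_nat_of_succ_le (cantorIndex_succ_div_add_le hw hg t)
  rcases le_total m n with h | h
  · exact (cantorIndex_div_mono hw t h).trans (by simpa using cantorRadius_nonneg n)
  · exact le_trans (by simpa using cantorRadius_nonneg m) (hanti h)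

theorem cantorPoint_mem_Icc (hw : ∀ n, 1 ≤ w n) (hg : ∀ n, 64 * w n ≤ w (n + 1))
    (t : ℝ) (n : ℕ) :
    (cantorIndex w t n : ℝ) / w n ≤ cantorPoint w t ∧
      cantorPoint w t ≤ cantorIndex w t n / w n + cantorRadius w n :=
  ⟨le_ciSup (f := fun n => (cantorIndex w t n : ℝ) / w n)
    ⟨_, by rintro _ ⟨m, rfl⟩; exact cantorIndex_div_le hw hg t m 0⟩ n,
    ciSup_le fun m => cantorIndex_div_le hw hg t m n⟩

theorem cantorPoint_bounds (hw : ∀ n, 1 ≤ w n) (hg : ∀ n, 64 * w n ≤ w (n + 1)) (t : ℝ) :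
    0 ≤ cantorPoint w t ∧ cantorPoint w t ≤ 1 / 8 := by
  obtain ⟨h1, h2⟩ := cantorPoint_mem_Icc hw hg t 0
  simp only [cantorIndex, Nat.cast_zero, zero_div, zero_add] at h1 h2
  refine ⟨h1, h2.trans ((cantorRadius_le hw hg 0).trans ?_)⟩
  gcongr
  linarith [hw 0]

theorem cantorIndex_lt (hw : ∀ n, 1 ≤ w n) (hg : ∀ n, 64 * w n ≤ w (n + 1)) (t : ℝ) (n : ℕ) :
    (cantorIndex w t n : ℝ) < w n := by
  have h0 : 0 < w n := zero_lt_one.trans_le (hw _)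
  have h1 := (cantorPoint_mem_Icc hw hg t n).1.trans (cantorPoint_bounds hw hg t).2
  rw [div_le_iff₀ h0] at h1
  linarith

/-- Dropping the last mixed-radix digit of an address gives the address one level up. -/
theorem floor_mul_levelCount_succ (hw : ∀ n, 1 ≤ w n) (hg : ∀ n, 64 * w n ≤ w (n + 1))
    (t : ℝ) (n : ℕ) :
    ⌊t * levelCount w (n + 1)⌋₊ / childCount w n = ⌊t * levelCount w n⌋₊ := by
  have hpos : (childCount w n : ℝ) ≠ 0 := by
    exact_mod_cast (childCount_pos hw hg n).ne'
  rw [← Nat.floor_div_natCast]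
  congr 1
  rw [levelCount, Finset.prod_range_succ, Nat.cast_mul, ← mul_assoc, mul_div_cancel_right₀ _ hpos]
  rfl

theorem levelCount_bounds (hw : ∀ n, 1 ≤ w n) (hg : ∀ n, 64 * w n ≤ w (n + 1)) (n : ℕ) :
    √(w n) ≤ √(w 0) * (2 ^ n * levelCount w n) := by
  induction n with
  | zero => simp [levelCount]
  | succ n ih =>
    have h0 : 0 < w n := zero_lt_one.trans_le (hw _)
    have h1 : 0 < w (n + 1) := zero_lt_one.trans_le (hw _)
    have h2 := (childCount_bounds hw hg n).1
    have e : √(w (n + 1)) = √(w n) * √(w (n + 1) / w n) := by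
      rw [← Real.sqrt_mul h0.le, mul_div_cancel₀ _ h0.ne']
    have e2 : (levelCount w (n + 1) : ℝ) = levelCount w n * childCount w n := by
      rw [levelCount, Finset.prod_range_succ, Nat.cast_mul]; rfl
    rw [e, e2]
    calc _ ≤ (√(w 0) * (2 ^ n * levelCount w n)) * (2 * childCount w n) := by
          gcongr
          linarith
      _ = _ := by ring

theorem levelCount_pos (hw : ∀ n, 1 ≤ w n) (hg : ∀ n, 64 * w n ≤ w (n + 1)) (n : ℕ) :
    0 < levelCount w n :=
  Finset.prod_pos fun i _ => childCount_pos hw hg i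

theorem two_pow_le_levelCount (hw : ∀ n, 1 ≤ w n) (hg : ∀ n, 64 * w n ≤ w (n + 1)) (n : ℕ) :
    2 ^ n ≤ levelCount w n := by
  simpa [levelCount] using Finset.pow_card_le_prod (Finset.range n) (childCount w) 2
    fun i _ => (childCount_bounds hw hg i).2.2

/-- At the first level where the addresses differ, by `k` say, the parameters differ by at most `k +
1 ≤ 2k` units. The chosen midpoints are `k / w (m + 1)` apart, and the radius, at most `1 / (8 w (m
+ 1))`, consumes less than half of this gap. -/
theorem exists_separation (hw : ∀ n, 1 ≤ w n) (hg : ∀ n, 64 * w n ≤ w (n + 1)) {t t' : ℝ}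
    (ht0 : 0 ≤ t) (htt : t < t') (ht1 : t' < 1) :
    ∃ m k : ℕ, 1 ≤ k ∧ k ≤ childCount w m ∧
      t' - t ≤ 2 * k / levelCount w (m + 1) ∧
      k / (2 * w (m + 1)) ≤ cantorPoint w t' - cantorPoint w t := by
  have hex : ∃ n, ⌊t * levelCount w n⌋₊ ≠ ⌊t' * levelCount w n⌋₊ := by
    obtain ⟨n, hn⟩ := pow_unbounded_of_one_lt (1 / (t' - t)) (one_lt_two (α := ℝ))
    refine ⟨n, fun h => ?_⟩
    have hP : (2 : ℝ) ^ n ≤ levelCount w n := by exact_mod_cast two_pow_le_levelCount hw hg n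
    have h1 : 1 < (t' - t) * levelCount w n := by
      rw [div_lt_iff₀' (sub_pos.2 htt)] at hn
      exact hn.trans_le (mul_le_mul_of_nonneg_left hP (sub_pos.2 htt).le)
    have h2 := Nat.floor_le (a := t * levelCount w n) (by positivity)
    have h3 := Nat.lt_floor_add_one (t' * levelCount w n)
    rw [← h] at h3
    linarith
  classical
  obtain ⟨n, hn, hmin⟩ : ∃ n, ⌊t * levelCount w n⌋₊ ≠ ⌊t' * levelCount w n⌋₊ ∧
      ∀ l < n, ⌊t * levelCount w l⌋₊ = ⌊t' * levelCount w l⌋₊ :=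
    ⟨Nat.find hex, Nat.find_spec hex, fun l hl => not_not.1 (Nat.find_min hex hl)⟩
  have hn0 : n ≠ 0 := by
    rintro rfl
    apply hn
    simp only [levelCount, Finset.range_zero, Finset.prod_empty, Nat.cast_one, mul_one]
    rw [Nat.floor_eq_zero.2 (htt.trans ht1), Nat.floor_eq_zero.2 ht1]
  obtain ⟨m, rfl⟩ := Nat.exists_eq_succ_of_ne_zero hn0
  rw [Nat.succ_eq_add_one] at hn hmin
  have hidx : ∀ i ≤ m, cantorIndex w t i = cantorIndex w t' i := by
    intro i hi
    induction i with
    | zero => rfl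
    | succ i ih => rw [cantorIndex, cantorIndex, ih (by omega), hmin (i + 1) (by omega)]
  have hw1 : 0 < w (m + 1) := zero_lt_one.trans_le (hw _)
  have hP : (0 : ℝ) < levelCount w (m + 1) := by exact_mod_cast levelCount_pos hw hg (m + 1)
  -- The addresses agree at level `m`, so their whole difference `k` sits in the last digit.
  have hdiv : ⌊t * levelCount w (m + 1)⌋₊ / childCount w m =
      ⌊t' * levelCount w (m + 1)⌋₊ / childCount w m := by
    rw [floor_mul_levelCount_succ hw hg, floor_mul_levelCount_succ hw hg, hmin m (by omega)]
  have hle : ⌊t * levelCount w (m + 1)⌋₊ ≤ ⌊t' * levelCount w (m + 1)⌋₊ :=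
    Nat.floor_mono (by gcongr)
  have hpos := childCount_pos hw hg m
  have hi : cantorIndex w t (m + 1) = ⌈w (m + 1) * (cantorIndex w t' m / w m)⌉₊ +
      ⌊t * levelCount w (m + 1)⌋₊ % childCount w m := by
    rw [cantorIndex, hidx m le_rfl]
  have hi' : cantorIndex w t' (m + 1) = ⌈w (m + 1) * (cantorIndex w t' m / w m)⌉₊ +
      ⌊t' * levelCount w (m + 1)⌋₊ % childCount w m := by
    rw [cantorIndex]
  have hf : ⌊t' * levelCount w (m + 1)⌋₊ ≤ t' * levelCount w (m + 1) :=
    Nat.floor_le (by have := ht0.trans htt.le; positivity)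
  have hf2 := Nat.lt_floor_add_one (t' * levelCount w (m + 1))
  have hf3 : ⌊t * levelCount w (m + 1)⌋₊ ≤ t * levelCount w (m + 1) :=
    Nat.floor_le (by positivity)
  set T := ⌊t * levelCount w (m + 1)⌋₊
  set T' := ⌊t' * levelCount w (m + 1)⌋₊
  obtain ⟨k, hk⟩ := Nat.exists_eq_add_of_le hle
  have hk1 : 1 ≤ k := by omega
  have m1 := Nat.div_add_mod T (childCount w m)
  have m2 := Nat.div_add_mod T' (childCount w m)
  have m3 := Nat.mod_lt T' hpos
  rw [← hdiv] at m2
  have hii : cantorIndex w t' (m + 1) = cantorIndex w t (m + 1) + k := by omega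
  have hk1' : (1 : ℝ) ≤ k := by exact_mod_cast hk1
  refine ⟨m, k, hk1, by omega, ?_, ?_⟩
  · rw [le_div_iff₀ hP]
    have : (T' : ℝ) = T + k := by exact_mod_cast hk
    linarith
  · have p1 := (cantorPoint_mem_Icc hw hg t (m + 1)).2
    have p2 := (cantorPoint_mem_Icc hw hg t' (m + 1)).1
    have p3 := cantorRadius_le hw hg (m + 1)
    rw [hii, Nat.cast_add, add_div] at p2
    have e1 : (k : ℝ) / (2 * w (m + 1)) = k / w (m + 1) - k / (2 * w (m + 1)) := by
      field_simp; ring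
    have e2 : 1 / (8 * w (m + 1)) ≤ k / (2 * w (m + 1)) := by
      gcongr
      norm_num
    linarith

/-- Each step multiplies `w n ^ η` by at least `w n ^ ((b - 1) * η)`, which is eventually at least
`2`; the constant absorbs the initial levels. This pays for the factor `2 ^ n` in
`levelCount_bounds`. -/
theorem exists_two_pow_le (hw : ∀ n, 1 ≤ w n) (hg : ∀ n, 64 * w n ≤ w (n + 1)) {b : ℝ}
    (hb : 1 < b) (hlow : ∀ n, w n ^ b ≤ w (n + 1)) {η : ℝ} (hη : 0 < η) :
    ∃ K : ℝ, 0 < K ∧ ∀ n, 2 ^ n ≤ K * w n ^ η := by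
  have hgeo : ∀ n, (64 : ℝ) ^ n ≤ w n := fun n => by
    induction n with
    | zero => simpa using hw 0
    | succ n ih => rw [pow_succ]; linarith [hg n]
  have htop : Tendsto w atTop atTop :=
    tendsto_atTop_mono hgeo (tendsto_pow_atTop_atTop_of_one_lt (by norm_num))
  have h := ((tendsto_rpow_atTop (y := (b - 1) * η) (mul_pos (by linarith) hη)).comp
    htop).eventually_ge_atTop 2
  obtain ⟨m₀, hm₀⟩ := h.exists_forall_of_atTop
  refine ⟨2 ^ m₀, by positivity, fun n => ?_⟩
  rcases le_total n m₀ with hn | hn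
  · calc (2 : ℝ) ^ n ≤ 2 ^ m₀ := pow_le_pow_right₀ (by norm_num) hn
      _ ≤ _ := le_mul_of_one_le_right (by positivity) (Real.one_le_rpow (hw n) hη.le)
  · induction n, hn using Nat.le_induction with
    | base => exact le_mul_of_one_le_right (by positivity) (Real.one_le_rpow (hw _) hη.le)
    | succ n hn ih =>
      have h0 : 0 < w n := zero_lt_one.trans_le (hw _)
      have h2 := hm₀ n hn
      simp only [Function.comp_apply] at h2
      calc (2 : ℝ) ^ (n + 1) = 2 * 2 ^ n := by rw [pow_succ]; ring
        _ ≤ w n ^ ((b - 1) * η) * (2 ^ m₀ * w n ^ η) := by gcongr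
        _ = 2 ^ m₀ * (w n ^ b) ^ η := by
          rw [mul_left_comm, ← Real.rpow_add h0, ← Real.rpow_mul h0.le]
          ring_nf
        _ ≤ _ := by gcongr; exact hlow n

/-- With `N` children and `P` parent intervals, `k / N ≤ (k / N) ^ s` reduces the claim to bounding
`(2 w (m + 1) / N) ^ s` by a multiple of `P`. The former is of order at most `w m ^ (s (1 + b) /
2)`, while `P` is at least of order `√(w m) / 2 ^ m`. -/
theorem exists_holder_constant (hw : ∀ n, 1 ≤ w n) (hg : ∀ n, 64 * w n ≤ w (n + 1)) {b D : ℝ}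
    (hb : 1 < b) (hlow : ∀ n, w n ^ b ≤ w (n + 1)) (hup : ∀ n, w (n + 1) ≤ D * w n ^ b)
    {s : ℝ} (hs : 0 < s) (hsb : s * (1 + b) < 1) :
    ∃ K : ℝ, 0 < K ∧ ∀ m k : ℕ, 1 ≤ k → k ≤ childCount w m →
      2 * k / levelCount w (m + 1) ≤ K * (k / (2 * w (m + 1))) ^ s := by
  -- The slack in the exponent: `1 / 2 = s (1 + b) / 2 + η`.
  set η := (1 - s * (1 + b)) / 2 with hη
  obtain ⟨K, hK, h2⟩ := exists_two_pow_le hw hg hb hlow (η := η) (by rw [hη]; linarith)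
  have hw0 : 0 < w 0 := zero_lt_one.trans_le (hw 0)
  have hD : 0 < D := by
    have := hup 0
    have h1 : 0 < w 1 := zero_lt_one.trans_le (hw 1)
    exact pos_of_mul_pos_left (h1.trans_le this) (by positivity)
  refine ⟨2 * (16 * D) ^ (s / 2) * K * √(w 0), by positivity, fun m k hk1 hk => ?_⟩
  have hm : 0 < w m := zero_lt_one.trans_le (hw m)
  have hm1 : 0 < w (m + 1) := zero_lt_one.trans_le (hw _)
  have hP : (0 : ℝ) < levelCount w m := by exact_mod_cast levelCount_pos hw hg m
  obtain ⟨hN, -, -⟩ := childCount_bounds hw hg m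
  have hNpos := childCount_pos hw hg m
  have hNpos' : (0 : ℝ) < childCount w m := by exact_mod_cast hNpos
  have hk0 : (0 : ℝ) < k := by exact_mod_cast hk1
  have hkN : (k : ℝ) ≤ childCount w m := by exact_mod_cast hk
  have hs1 : s ≤ 1 := by nlinarith
  set N : ℝ := (childCount w m : ℝ)
  set P : ℝ := (levelCount w m : ℝ)
  have e2 : (levelCount w (m + 1) : ℝ) = P * N := by
    rw [levelCount, Finset.prod_range_succ, Nat.cast_mul]; rfl
  have hratio : (2 * w (m + 1) / N) ^ s ≤ (16 * D) ^ (s / 2) * w m ^ (s * (1 + b) / 2) := by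
    have h3 : (2 * w (m + 1) / N) ^ 2 ≤ 16 * D * w m ^ (1 + b) := by
      have hN2 : w (m + 1) / w m ≤ 4 * N ^ 2 := by
        rw [← Real.sq_sqrt (x := w (m + 1) / w m) (by positivity)]
        nlinarith [Real.sqrt_nonneg (w (m + 1) / w m)]
      rw [div_le_iff₀ hm] at hN2
      rw [div_pow, div_le_iff₀ (by positivity), Real.rpow_add hm, Real.rpow_one]
      calc (2 * w (m + 1)) ^ 2 = 4 * w (m + 1) * w (m + 1) := by ring
        _ ≤ 4 * (D * w m ^ b) * (4 * N ^ 2 * w m) := by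
          have := hup m
          gcongr
        _ = _ := by ring
    calc (2 * w (m + 1) / N) ^ s = ((2 * w (m + 1) / N) ^ 2) ^ (s / 2) := by
          rw [← Real.rpow_natCast, ← Real.rpow_mul (by positivity)]
          congr 1; push_cast; ring
      _ ≤ (16 * D * w m ^ (1 + b)) ^ (s / 2) := by gcongr
      _ = _ := by
        rw [Real.mul_rpow (by positivity) (by positivity), ← Real.rpow_mul hm.le]
        ring_nf
  have hPlow : w m ^ (s * (1 + b) / 2) ≤ K * √(w 0) * P := by
    have h4 := levelCount_bounds hw hg m
    rw [Real.sqrt_eq_rpow, show (1 : ℝ) / 2 = s * (1 + b) / 2 + η by rw [hη]; ring,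
      Real.rpow_add hm] at h4
    have hη0 : 0 < w m ^ η := by positivity
    refine le_of_mul_le_mul_right ?_ hη0
    calc _ ≤ √(w 0) * (2 ^ m * P) := h4
      _ ≤ √(w 0) * (K * w m ^ η * P) := by
        have := h2 m
        gcongr
      _ = _ := by ring
  have hkpow : (k : ℝ) / N ≤ (k / N) ^ s :=
    Real.self_le_rpow_of_le_one (by positivity) ((div_le_one hNpos').2 hkN) hs1
  have hsplit : ((k : ℝ) / N) ^ s = (k / (2 * w (m + 1))) ^ s * (2 * w (m + 1) / N) ^ s := by
    rw [← Real.mul_rpow (by positivity) (by positivity)]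
    congr 1
    field_simp
  rw [e2]
  calc 2 * (k : ℝ) / (P * N) = 2 / P * (k / N) := by field_simp
    _ ≤ 2 / P * ((k / (2 * w (m + 1))) ^ s * ((16 * D) ^ (s / 2) * (K * √(w 0) * P))) := by
      gcongr
      refine hkpow.trans (hsplit.le.trans ?_)
      gcongr
      exact hratio.trans (by gcongr)
    _ = _ := by field_simp

theorem exists_abs_sub_le_mul_rpow (hw : ∀ n, 1 ≤ w n) (hg : ∀ n, 64 * w n ≤ w (n + 1))
    {b D : ℝ} (hb : 1 < b) (hlow : ∀ n, w n ^ b ≤ w (n + 1))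
    (hup : ∀ n, w (n + 1) ≤ D * w n ^ b) {s : ℝ} (hs : 0 < s) (hsb : s * (1 + b) < 1) :
    ∃ K : ℝ, 0 < K ∧ ∀ t ∈ Set.Ico (0 : ℝ) 1, ∀ t' ∈ Set.Ico (0 : ℝ) 1,
      |t - t'| ≤ K * |cantorPoint w t - cantorPoint w t'| ^ s := by
  obtain ⟨K, hK, h⟩ := exists_holder_constant hw hg hb hlow hup hs hsb
  have key : ∀ t t' : ℝ, 0 ≤ t → t < t' → t' < 1 →
      |t - t'| ≤ K * |cantorPoint w t - cantorPoint w t'| ^ s := by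
    intro t t' h0 htt h1
    obtain ⟨m, k, hk1, hk, h3, h4⟩ := exists_separation hw hg h0 htt h1
    rw [abs_sub_comm, abs_of_pos (sub_pos.2 htt)]
    have hw1 : 0 < w (m + 1) := zero_lt_one.trans_le (hw _)
    refine (h3.trans (h m k hk1 hk)).trans ?_
    gcongr
    rw [abs_sub_comm]
    exact h4.trans (le_abs_self _)
  refine ⟨K, hK, fun t ht t' ht' => ?_⟩
  rcases lt_trichotomy t t' with hlt | rfl | hlt
  · exact key t t' ht.1 hlt ht'.2
  · rw [sub_self, abs_zero]; positivity
  · rw [abs_sub_comm, abs_sub_comm (cantorPoint w t)]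
    exact key t' t ht'.1 hlt ht.2

end Cantor

/-! ### Hausdorff dimension of the Cantor-type sets -/

/-- The hypothesis makes `g` injective on `S` with an `s`-Hölder inverse, and an `s`-Hölder map
enlarges dimension by a factor of at most `1 / s`. -/
theorem mul_dimH_le_of_expanding {X Y : Type*} [EMetricSpace X] [EMetricSpace Y]
    {g : Y → X} {S : Set Y} {K s : NNReal} (hs : 0 < s)
    (h : ∀ y ∈ S, ∀ y' ∈ S, edist y y' ≤ K * edist (g y) (g y') ^ (s : ℝ)) :
    s * dimH S ≤ dimH (g '' S) := by
  rcases S.eq_empty_or_nonempty with rfl | ⟨y₀, hy₀⟩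
  · simp
  have hs0 : (0 : ℝ) < s := hs
  have : Nonempty Y := ⟨y₀⟩
  have hinj : Set.InjOn g S := by
    intro y hy y' hy' e
    have := h y hy y' hy'
    rw [e, edist_self, ENNReal.zero_rpow_of_pos hs0, mul_zero] at this
    exact edist_le_zero.1 this
  have hinv : ∀ y ∈ S, Function.invFunOn g S (g y) = y := fun y hy =>
    hinj.leftInvOn_invFunOn hy
  have hH : HolderOnWith K s (Function.invFunOn g S) (g '' S) := by
    rintro _ ⟨y, hy, rfl⟩ _ ⟨y', hy', rfl⟩
    rw [hinv y hy, hinv y' hy']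
    exact h y hy y' hy'
  have himg : Function.invFunOn g S '' (g '' S) = S := by
    rw [Set.image_image]
    exact (Set.image_congr hinv).trans (Set.image_id' S)
  have h1 := hH.dimH_image_le hs
  rw [himg] at h1
  rw [mul_comm]
  exact ENNReal.mul_le_of_le_div h1

theorem coe_cantorPoint_mem_cantorTypeSet {α : ℝ} (h : Irrational α)
    (hgrow : ∀ n, 1 ≤ n → 64 * cfDen α n ≤ cfDen α (n + 1)) (t : ℝ) :
    (cantorPoint (fun n => cfDen α (n + 1)) t : UnitAddCircle) ∈ cantorTypeSet α := by
  have hw : ∀ n, 1 ≤ (fun n => cfDen α (n + 1)) n := fun n => one_le_cfDen h _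
  have hg : ∀ n, 64 * (fun n => cfDen α (n + 1)) n ≤ (fun n => cfDen α (n + 1)) (n + 1) :=
    fun n => hgrow _ (by omega)
  simp only [cantorTypeSet, Set.mem_iInter, Set.mem_iUnion]
  intro n hn
  obtain ⟨n, rfl⟩ := Nat.exists_eq_add_of_le' hn
  have h1 := cantorPoint_mem_Icc hw hg t n
  refine ⟨cantorIndex _ t n, cantorIndex_lt hw hg t n, _, ⟨?_, h1.2⟩, rfl⟩
  exact (sub_le_self _ (by positivity)).trans h1.1

theorem exists_expanding_map {α : ℝ} (h : Irrational α)
    (hgrow : ∀ n, 1 ≤ n → 64 * cfDen α n ≤ cfDen α (n + 1)) {b D : ℝ} (hb : 1 < b)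
    (hlow : ∀ n, 1 ≤ n → cfDen α n ^ b ≤ cfDen α (n + 1))
    (hup : ∀ n, 1 ≤ n → cfDen α (n + 1) ≤ D * cfDen α n ^ b) {s : NNReal} (hs : 0 < s)
    (hsb : s * (1 + b) < 1) :
    ∃ (g : ℝ → UnitAddCircle) (K : NNReal), (∀ t, g t ∈ cantorTypeSet α) ∧
      ∀ t ∈ Set.Ico (0 : ℝ) 1, ∀ t' ∈ Set.Ico (0 : ℝ) 1,
        edist t t' ≤ K * edist (g t) (g t') ^ (s : ℝ) := by
  have hw : ∀ n, 1 ≤ (fun n => cfDen α (n + 1)) n := fun n => one_le_cfDen h _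
  have hg : ∀ n, 64 * (fun n => cfDen α (n + 1)) n ≤ (fun n => cfDen α (n + 1)) (n + 1) :=
    fun n => hgrow _ (by omega)
  obtain ⟨K, hK, hexp⟩ := exists_abs_sub_le_mul_rpow hw hg hb (fun n => hlow _ (by omega))
    (fun n => hup _ (by omega)) (s := s) hs hsb
  refine ⟨fun t => (cantorPoint (fun n => cfDen α (n + 1)) t : UnitAddCircle), K.toNNReal,
    coe_cantorPoint_mem_cantorTypeSet h hgrow, fun t ht t' ht' => ?_⟩
  set x := cantorPoint (fun n => cfDen α (n + 1)) t with hx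
  set x' := cantorPoint (fun n => cfDen α (n + 1)) t' with hx'
  have b1 := cantorPoint_bounds hw hg t
  have b2 := cantorPoint_bounds hw hg t'
  -- Both points lie in `[0, 1 / 8]`, so the circle distance does not wrap around.
  have hdist : dist (x : UnitAddCircle) (x' : UnitAddCircle) = |x - x'| := by
    rw [dist_eq_norm, ← AddCircle.coe_sub, AddCircle.norm_coe_eq_abs_iff _ one_ne_zero]
    rw [abs_one, abs_le]
    constructor <;> linarith [b1.1, b1.2, b2.1, b2.2]
  rw [edist_dist, edist_dist, hdist, Real.dist_eq,
    ENNReal.ofReal_rpow_of_nonneg (abs_nonneg _) s.coe_nonneg, ← ENNReal.ofReal_coe_nnreal,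
    Real.coe_toNNReal _ hK.le, ← ENNReal.ofReal_mul hK.le]
  exact ENNReal.ofReal_le_ofReal (hexp t ht t' ht')

theorem mul_le_dimH_pi_cantorTypeSet {d : ℕ} {α : Fin d → ℝ} {s : NNReal} (hs : 0 < s)
    (hexp : ∀ j, ∃ (g : ℝ → UnitAddCircle) (K : NNReal), (∀ t, g t ∈ cantorTypeSet (α j)) ∧
      ∀ t ∈ Set.Ico (0 : ℝ) 1, ∀ t' ∈ Set.Ico (0 : ℝ) 1,
        edist t t' ≤ K * edist (g t) (g t') ^ (s : ℝ)) :
    s * (d : ENNReal) ≤ dimH (Set.univ.pi fun j => cantorTypeSet (α j)) := by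
  choose g K hmem hg using hexp
  set S : Set (Fin d → ℝ) := Set.univ.pi fun _ => Set.Ico 0 1 with hS
  have hdim : dimH S = d := by
    rw [Real.dimH_of_nonempty_interior, Module.finrank_fin_fun]
    refine ⟨fun _ => 1 / 2, ?_⟩
    rw [hS, interior_pi_set Set.finite_univ, Set.mem_univ_pi]
    intro j
    rw [interior_Ico]
    constructor <;> norm_num
  have h := mul_dimH_le_of_expanding (S := S) (g := fun y j => g j (y j))
    (K := ∑ j, K j) hs fun y hy y' hy' => by
      rw [hS, Set.mem_univ_pi] at hy hy'
      refine edist_pi_le_iff.2 fun j => (hg j _ (hy j) _ (hy' j)).trans ?_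
      gcongr
      · exact Finset.single_le_sum (fun i _ => zero_le) (Finset.mem_univ j)
      · exact edist_le_pi_edist (fun i => g i (y i)) (fun i => g i (y' i)) j
  rw [hdim] at h
  refine h.trans (dimH_mono ?_)
  rintro _ ⟨y, -, rfl⟩
  exact fun j _ => hmem j _

theorem le_dimH_cantorTypeSet {α : ℝ} {s : NNReal} (hs : 0 < s)
    (hexp : ∃ (g : ℝ → UnitAddCircle) (K : NNReal), (∀ t, g t ∈ cantorTypeSet α) ∧
      ∀ t ∈ Set.Ico (0 : ℝ) 1, ∀ t' ∈ Set.Ico (0 : ℝ) 1,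
        edist t t' ≤ K * edist (g t) (g t') ^ (s : ℝ)) :
    (s : ENNReal) ≤ dimH (cantorTypeSet α) := by
  obtain ⟨g, K, hmem, hg⟩ := hexp
  have h := mul_dimH_le_of_expanding hs hg
  rw [Real.dimH_of_nonempty_interior (by simp), Module.finrank_self, Nat.cast_one, mul_one] at h
  refine h.trans (dimH_mono ?_)
  rintro _ ⟨y, -, rfl⟩
  exact hmem _

theorem ofReal_mul_le_of_forall_lt {c : ℝ} (hc : 0 < c) (k : ℕ) {L : ENNReal}
    (h : ∀ s : NNReal, 0 < s → (s : ℝ) < c → s * (k : ENNReal) ≤ L) :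
    ENNReal.ofReal (k * c) ≤ L := by
  have hlim : Tendsto (fun s : ℝ => ENNReal.ofReal (k * s)) (𝓝[<] c)
      (𝓝 (ENNReal.ofReal (k * c))) :=
    ((ENNReal.continuous_ofReal.comp (continuous_const.mul continuous_id)).tendsto c).mono_left
      nhdsWithin_le_nhds
  refine le_of_tendsto hlim ?_
  filter_upwards [Ioo_mem_nhdsLT hc] with s hs
  have := h ⟨s, hs.1.le⟩ hs.1 hs.2
  rwa [mul_comm, ENNReal.ofReal_mul hs.1.le, ENNReal.ofReal_natCast,
    ENNReal.ofReal_eq_coe_nnreal hs.1.le]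

theorem InterlacedDenominators.exists_expanding_map {d : ℕ} (hd : 3 ≤ d) {a : ℝ} (ha : 1 < a)
    {α : Fin d → ℝ} (hα : InterlacedDenominators a α) {s : NNReal} (hs : 0 < s)
    (hsa : (s : ℝ) < 1 / (1 + a ^ d)) (j : Fin d) :
    ∃ (g : ℝ → UnitAddCircle) (K : NNReal), (∀ t, g t ∈ cantorTypeSet (α j)) ∧
      ∀ t ∈ Set.Ico (0 : ℝ) 1, ∀ t' ∈ Set.Ico (0 : ℝ) 1,
        edist t t' ≤ K * edist (g t) (g t') ^ (s : ℝ) := by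
  obtain ⟨D, -, hup⟩ := hα.exists_le_mul_rpow (by omega) ha j
  refine _root_.exists_expanding_map (hα.1 j) (fun n hn => hα.mul_le hd ha j hn)
    (one_lt_pow₀ ha (by omega)) (fun n hn => ?_) hup hs
    ((lt_div_iff₀ (by positivity)).1 hsa)
  refine le_trans ?_ (hα.pow_mul_rpow_le (by omega) ha j hn)
  have := one_le_cfDen (hα.1 j) n
  exact le_mul_of_one_le_left (by positivity) (one_le_pow₀ (by norm_num))

end

theorem mainTheorem6 (d : ℕ) (hd : 3 ≤ d) (a : ℝ) (ha : 1 < a) (hbar : 0 < aBar d a)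
    (ε : ℝ) (hε : 0 < ε) (hεa : ε < aBar d a)
    (α : Fin d → ℝ) (hα : InterlacedDenominators a α) :
    (∀ j : Fin d, ENNReal.ofReal (1 / (1 + a ^ d)) ≤ dimH (cantorTypeSet (α j))) ∧
    Set.univ.pi (fun j : Fin d => cantorTypeSet (α j)) ⊆
      discreteOrbitSet α (torusCocycle (aBar d a) ε α) ∧
    ENNReal.ofReal (d / (1 + a ^ d)) ≤
      dimH (Set.univ.pi (fun j : Fin d => cantorTypeSet (α j))) ∧
    0 < (d : ℝ) / (1 + a ^ d) := by
  have hc : 0 < 1 / (1 + a ^ d) := by positivity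
  refine ⟨fun j => ?_, pi_cantorTypeSet_subset_discreteOrbitSet hd ha hbar hε hεa hα, ?_, ?_⟩
  · have h := ofReal_mul_le_of_forall_lt hc 1 (L := dimH (cantorTypeSet (α j)))
      fun s hs hsa => by
        rw [Nat.cast_one, mul_one]
        exact le_dimH_cantorTypeSet hs (hα.exists_expanding_map hd ha hs hsa j)
    rwa [Nat.cast_one, one_mul] at h
  · rw [← mul_one_div]
    exact ofReal_mul_le_of_forall_lt hc d fun s hs hsa =>
      mul_le_dimH_pi_cantorTypeSet hs (hα.exists_expanding_map hd ha hs hsa)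
  · have : (0 : ℝ) < d := by exact_mod_cast (by omega : 0 < d)
    positivity
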